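/- **Conventions.** Fix an infinite field $k$ and a finite set $V$ with $n=|V|$. Simplicial complexes are finite and contain the empty face. - A *homology sphere* of dimension $d$ (over $k$) is a $d$-dimensional simplicial complex in which the link of every face $F$ (including $\emptyset$) has the reduced $k$-homology of a $(d-|F|)$-sphere. A *homology ball* of dimension $d$ is a $d$-dimensional complex $\Delta$ with vanishing reduced $k$-homology that has a subcomplex $\partial\Delta$ such that: $\partial\Delta$ is a homology sphere of dimension $d-1$; $\mathrm{lk}_\Delta(F)$ is a homology sphere of dimension $d-|F|$ for every face $F\notin\partial\Delta$; and $\mathrm{lk}_\Delta(F)$ is a homology ball of dimension $d-|F|$ for every nonempty $F\in\partial\Delta$. The interior faces of $\Delta$ are those not in $\partial\Delta$. - A *homology triangulation* of the simplex $2^V$ is a simplicial complex $\Gamma$ with a map $\sigma\colon\Gamma\to 2^V$ such that, for every nonempty $U\subseteq V$, $\Gamma_U:=\sigma^{-1}(2^U)$ is a homology ball of dimension $|U|-1$ whose set of interior faces is $\sigma^{-1}(U)$; also $\sigma^{-1}(\emptyset)=\{\emptyset\}$ (automatic if $V\ne\emptyset$). The set $\sigma(F)$ is the *carrier* of $F$.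 The triangulation is *quasi-geometric* if there are no face $F$ and $U\subseteq V$ such that $\dim\Gamma_U<\dim F$ and the carrier of every vertex of $F$ is contained in $U$. - $k[\Delta]$ is the face ring of $\Delta$ (the polynomial ring on the vertices modulo the squarefree monomials $x^F$ with $F\notin\Delta$), graded by degree. For a subcomplex $\Delta'\subseteq\Delta$, the restriction $k[\Delta]\to k[\Delta']$, $\theta\mapsto\theta|_{\Delta'}$, sends $x^F$ to $x^F$ if $F\in\Delta'$ and to $0$ otherwise, and $\iota\colon k[\Delta']\to k[\Delta]$ is the $k$-linear inclusion that sends each monomial supported on a face of $\Delta'$ to itself. An *l.s.o.p.* for $k[\Delta]$, where $d=\dim k[\Delta]$ is the Krull dimension, is a sequence $\theta_1,\dots,\theta_d\in k[\Delta]_1$ such that $k[\Delta]/(\theta_1,\dots,\theta_d)$ is finite-dimensional over $k$. The support of $\sum a_wx_w$ is $\{w:a_w\neq0\}$. - For a face $E\in\Gamma$, an l.s.o.p. $\theta_1,\dots,\theta_d$ of $k[\mathrm{lk}_\Gamma(E)]$ is *special* if one can assign to the elements $v\in V\smallsetminus\sigma(E)$ distinct members $\theta_v$ of the l.s.o.p.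 such that every vertex in the support of $\theta_v$ has $v$ in its carrier. Such an assignment is called a *labelling*. Given a special l.s.o.p., $L(\Gamma,E)$ is the image in $k[\mathrm{lk}_\Gamma(E)]/(\theta_1,\dots,\theta_d)$ of the ideal generated by the $x^F$ with $F\in\mathrm{lk}_\Gamma(E)$ and $\sigma(F\sqcup E)=V$. **Theorem.** Let $\sigma\colon\Gamma\to2^V$ be a quasi-geometric homology triangulation, let $E\subseteq E'$ be faces of $\Gamma$, and put $d=n-|E|$, $d'=n-|E'|$. Let $\theta_1,\dots,\theta_d$ be a special l.s.o.p. for $k[\mathrm{lk}_\Gamma(E)]$. Let $\mathrm{Star}(E'\smallsetminus E)$ be the closed star of $E'\smallsetminus E$ in $\mathrm{lk}_\Gamma(E)$, and let $\theta'_i=\theta_i|_{\mathrm{Star}(E'\smallsetminus E)}$. Identify $k[\mathrm{lk}_\Gamma(E')]$ via $\iota$ with a subalgebra of $k[\mathrm{Star}(E'\smallsetminus E)]$, and put $J=k[\mathrm{lk}_\Gamma(E')]\cap(\theta'_1,\dots,\theta'_{d})$. 1. There is a unique homomorphism of graded $k[\mathrm{lk}_\Gamma(E')]$-algebras $$\varphi\colon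 k[\mathrm{lk}_\Gamma(E)]/(\theta_1,\dots,\theta_d)\longrightarrow k[\mathrm{lk}_\Gamma(E')]/J$$ whose kernel contains $[x^F]$ for every face $F\in\mathrm{lk}_\Gamma(E)$ with $F\notin\mathrm{Star}(E'\smallsetminus E)$. Here "homomorphism of graded $k[\mathrm{lk}_\Gamma(E')]$-algebras" means a degree-preserving homomorphism of $k$-algebras such that $\varphi([\iota(r)]\,y)=r\,\varphi(y)$ for all $r\in k[\mathrm{lk}_\Gamma(E')]$ and all $y$, where $\iota\colon k[\mathrm{lk}_\Gamma(E')]\to k[\mathrm{lk}_\Gamma(E)]$ is the linear inclusion. 2. For every labelling $v\mapsto\theta_v$ of $\theta_1,\dots,\theta_d$, there is a special l.s.o.p. $\zeta_1,\dots,\zeta_{d'}$ for $k[\mathrm{lk}_\Gamma(E')]$, with a labelling $v\mapsto\zeta_v$ ($v\in V\smallsetminus\sigma(E')$), such that $$(\zeta_1,\dots,\zeta_{d'})=J\qquad\text{and}\qquad \theta_v|_{\mathrm{lk}_\Gamma(E')}=\zeta_v\quad\text{for all } v\in V\smallsetminus\sigma(E'),$$ and such that, with $L(\Gamma,E')$ formed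 using $\zeta_1,\dots,\zeta_{d'}$, one has $\varphi(L(\Gamma,E))\subseteq L(\Gamma,E')$. -/

import Mathlib

noncomputable section

namespace LocalFace

/-! ### Simplicial complexes -/

/-- An abstract simplicial complex whose vertices lie in `W`. The empty set is a face; an element
of `W` need not be a vertex. -/
structure SimplComplex (W : Type*) where
  faces : Set (Finset W)
  empty_mem : ∅ ∈ faces
  down_closed : ∀ {F G : Finset W}, G ∈ faces → F ⊆ G → F ∈ faces

section Complexes

variable {W : Type*}

instance : Membership (Finset W) (SimplComplex W) := ⟨fun Δ F => F ∈ Δ.faces⟩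

/-- `Δ' ≤ Δ` means that `Δ'` is a subcomplex of `Δ`. -/
instance : LE (SimplComplex W) := ⟨fun Δ' Δ => ∀ F : Finset W, F ∈ Δ' → F ∈ Δ⟩

/-- The dimension: the largest cardinality of a face, minus one (meant for finite `W`). -/
def SimplComplex.dim (Δ : SimplComplex W) : ℤ :=
  ((sSup (Finset.card '' Δ.faces) : ℕ) : ℤ) - 1

variable [DecidableEq W]

/-- The link of a face `E`: the faces `F` disjoint from `E` such that `F ∪ E` is a face. -/
def SimplComplex.link (Δ : SimplComplex W) (E : Finset W) (hE : E ∈ Δ) : SimplComplex W where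
  faces := {F | Disjoint F E ∧ F ∪ E ∈ Δ}
  empty_mem := ⟨Finset.disjoint_empty_left E, by rwa [Finset.empty_union]⟩
  down_closed := fun hG h =>
    ⟨Disjoint.mono_left h hG.1, Δ.down_closed hG.2 (Finset.union_subset_union_left h)⟩

/-- The closed star of a face `S`: the faces `F` such that `F ∪ S` is a face. -/
def SimplComplex.closedStar (Δ : SimplComplex W) (S : Finset W) (hS : S ∈ Δ) :
    SimplComplex W where
  faces := {F | F ∪ S ∈ Δ}
  empty_mem := by
    change ∅ ∪ S ∈ Δ
    rwa [Finset.empty_union]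
  down_closed := fun hG h => Δ.down_closed hG (Finset.union_subset_union_left h)

theorem closedStar_le (Δ : SimplComplex W) (S : Finset W) (hS : S ∈ Δ) :
    Δ.closedStar S hS ≤ Δ :=
  fun _ hF => Δ.down_closed hF Finset.subset_union_left

theorem link_le_link (Δ : SimplComplex W) {E E' : Finset W} (hE : E ∈ Δ) (hE' : E' ∈ Δ)
    (h : E ⊆ E') : Δ.link E' hE' ≤ Δ.link E hE :=
  fun _ hF => ⟨Disjoint.mono_right h hF.1,
    Δ.down_closed hF.2 (Finset.union_subset_union_right h)⟩

theorem sdiff_mem_link (Δ : SimplComplex W) {E E' : Finset W} (hE : E ∈ Δ) (hE' : E' ∈ Δ)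
    (h : E ⊆ E') : E' \ E ∈ Δ.link E hE :=
  ⟨Finset.sdiff_disjoint, by rwa [Finset.sdiff_union_of_subset h]⟩

/-- The closed star of `E' \ E` in the link of `E`. -/
def starIn (Δ : SimplComplex W) {E E' : Finset W} (hE : E ∈ Δ) (hE' : E' ∈ Δ) (h : E ⊆ E') :
    SimplComplex W :=
  (Δ.link E hE).closedStar (E' \ E) (sdiff_mem_link Δ hE hE' h)

theorem starIn_le (Δ : SimplComplex W) {E E' : Finset W} (hE : E ∈ Δ) (hE' : E' ∈ Δ)
    (h : E ⊆ E') : starIn Δ hE hE' h ≤ Δ.link E hE :=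
  closedStar_le _ _ _

theorem union_sdiff_union {E E' : Finset W} (F : Finset W) (h : E ⊆ E') :
    F ∪ E' \ E ∪ E = F ∪ E' := by
  rw [Finset.union_assoc, Finset.sdiff_union_of_subset h]

theorem link_le_starIn (Δ : SimplComplex W) {E E' : Finset W} (hE : E ∈ Δ) (hE' : E' ∈ Δ)
    (h : E ⊆ E') : Δ.link E' hE' ≤ starIn Δ hE hE' h := by
  intro F hF
  refine ⟨?_, ?_⟩
  · exact Finset.disjoint_union_left.2 ⟨Disjoint.mono_right h hF.1, Finset.sdiff_disjoint⟩
  · rw [union_sdiff_union F h]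
    exact hF.2

/-- `Δ'` is a full subcomplex of `Δ`: it contains every face of `Δ` on its own vertices. -/
def IsFull (Δ' Δ : SimplComplex W) : Prop :=
  Δ' ≤ Δ ∧ ∀ F : Finset W, F ∈ Δ → (∀ w ∈ F, ({w} : Finset W) ∈ Δ') → F ∈ Δ'

theorem link_full_starIn (Δ : SimplComplex W) {E E' : Finset W} (hE : E ∈ Δ) (hE' : E' ∈ Δ)
    (h : E ⊆ E') : IsFull (Δ.link E' hE') (starIn Δ hE hE' h) := by
  refine ⟨link_le_starIn Δ hE hE' h, fun F hF hv => ⟨?_, ?_⟩⟩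
  · rw [Finset.disjoint_left]
    intro w hw
    exact Finset.disjoint_singleton_left.1 (hv w hw).1
  · have := hF.2
    rwa [union_sdiff_union F h] at this

end Complexes

/-! ### Reduced simplicial homology, homology spheres and homology balls -/

section Homology

variable (k : Type*) [Field k] {W : Type*}

/-- Oriented simplicial chains on `m`-element faces (of dimension `m - 1`), as alternating
functions on `m`-tuples of vertices: the chain sends `(w₁, …, wₘ)` to the coefficient of the
oriented simplex `[w₁, …, wₘ]`, and vanishes on tuples that do not list the vertices of a face
without repetition. For `m = 0` these are the multiples of the empty simplex. -/
def chains [DecidableEq W] (Δ : SimplComplex W) (m : ℕ) : Submodule k ((Fin m → W) → k) where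
  carrier := {c |
    (∀ (π : Equiv.Perm (Fin m)) (t : Fin m → W),
      c (t ∘ π) = (((Equiv.Perm.sign π : ℤˣ) : ℤ) : k) * c t) ∧
    ∀ t : Fin m → W, ¬ (Function.Injective t ∧ Finset.univ.image t ∈ Δ) → c t = 0}
  zero_mem' := ⟨by simp, by simp⟩
  add_mem' := fun {a b} ha hb =>
    ⟨fun π t => by simp only [Pi.add_apply, ha.1 π t, hb.1 π t, mul_add],
      fun t ht => by simp only [Pi.add_apply, ha.2 t ht, hb.2 t ht, add_zero]⟩
  smul_mem' := fun r a ha =>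
    ⟨fun π t => by simp only [Pi.smul_apply, ha.1 π t, smul_eq_mul]; ring,
      fun t ht => by simp only [Pi.smul_apply, ha.2 t ht, smul_zero]⟩

/-- The boundary operator, `(∂ c)(w₁, …, wₘ) = ∑ w, c (w, w₁, …, wₘ)`; it is the linear map with
`∂ [w₀, …, wₘ] = ∑ i, (-1) ^ i [w₀, …, ŵᵢ, …, wₘ]`. For `m = 0` it is the augmentation. -/
def boundary [Fintype W] (m : ℕ) : ((Fin (m + 1) → W) → k) →ₗ[k] ((Fin m → W) → k) where
  toFun c := fun t => ∑ w : W, c (Fin.cons w t)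
  map_add' := fun a b => by
    funext t
    simp only [Pi.add_apply, Finset.sum_add_distrib]
  map_smul' := fun r a => by
    funext t
    simp only [Pi.smul_apply, smul_eq_mul, RingHom.id_apply, Finset.mul_sum]

variable [Fintype W] [DecidableEq W]

/-- Cycles among the chains on `m`-element faces. -/
def cycles (Δ : SimplComplex W) : (m : ℕ) → Submodule k ((Fin m → W) → k)
  | 0 => chains k Δ 0
  | m + 1 => chains k Δ (m + 1) ⊓ LinearMap.ker (boundary k m)

/-- Boundaries among the chains on `m`-element faces. -/
def boundaries (Δ : SimplComplex W) (m : ℕ) : Submodule k ((Fin m → W) → k) :=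
  (chains k Δ (m + 1)).map (boundary k m)

/-- `reducedBetti k Δ m` is the dimension of the reduced homology of `Δ` over `k` in homological
degree `m - 1`. -/
def reducedBetti (Δ : SimplComplex W) (m : ℕ) : ℕ :=
  Module.finrank k (cycles k Δ m ⧸ (boundaries k Δ m).submoduleOf (cycles k Δ m))

/-- A homology sphere of dimension `d` over `k`: a `d`-dimensional complex such that the link of
each face `F` (the empty face included) has the reduced homology of a `(d - |F|)`-dimensional
sphere. The complex `{∅}` is the sphere of dimension `-1`. -/
def IsHomologySphere (d : ℤ) (Δ : SimplComplex W) : Prop :=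
  Δ.dim = d ∧ ∀ (F : Finset W) (hF : F ∈ Δ) (m : ℕ),
    reducedBetti k (Δ.link F hF) m = if (m : ℤ) - 1 = d - F.card then 1 else 0

/-- `IsHomologyBall k d Δ B`: the complex `Δ` is a homology ball of dimension `d` over `k` with
boundary complex `B`. Its interior faces are its faces not in `B`. -/
inductive IsHomologyBall : ℤ → SimplComplex W → SimplComplex W → Prop
  | mk (d : ℤ) (Δ B : SimplComplex W) (B' : Finset W → SimplComplex W)
      (dim_eq : Δ.dim = d)
      (acyclic : ∀ m : ℕ, reducedBetti k Δ m = 0)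
      (le : B ≤ Δ)
      (boundary_sphere : IsHomologySphere k (d - 1) B)
      (link_interior : ∀ (F : Finset W) (hF : F ∈ Δ), F ∉ B →
        IsHomologySphere k (d - F.card) (Δ.link F hF))
      (link_boundary : ∀ (F : Finset W) (hF : F ∈ Δ), F ∈ B → F.Nonempty →
        IsHomologyBall (d - F.card) (Δ.link F hF) (B' F)) :
      IsHomologyBall d Δ B

end Homology

/-! ### Triangulations of simplices -/

/-- A simplicial complex `Γ` with a carrier map `σ : Γ → 2^V` for which the preimages of the sets
`2^U` are subcomplexes, and only the empty face is carried by the empty set. The values of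
`carrier` outside `Γ` play no role. -/
structure CarriedComplex (W V : Type*) where
  complex : SimplComplex W
  carrier : Finset W → Finset V
  carrier_mono : ∀ {F G : Finset W}, G ∈ complex → F ⊆ G → carrier F ⊆ carrier G
  carrier_eq_empty : ∀ F : Finset W, F ∈ complex → (carrier F = ∅ ↔ F = ∅)

section Triangulations

variable {W V : Type*}

/-- The subcomplex `Γ_U = σ⁻¹(2^U)`. -/
def CarriedComplex.restrictTo (T : CarriedComplex W V) (U : Finset V) : SimplComplex W where
  faces := {F | F ∈ T.complex ∧ T.carrier F ⊆ U}
  empty_mem := ⟨T.complex.empty_mem, by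
    rw [(T.carrier_eq_empty ∅ T.complex.empty_mem).2 rfl]
    exact Finset.empty_subset U⟩
  down_closed := fun hG h =>
    ⟨T.complex.down_closed hG.1 h, (T.carrier_mono hG.1 h).trans hG.2⟩

/-- `σ : Γ → 2^V` is a homology triangulation of the simplex `2^V` over `k`: for each nonempty
`U ⊆ V`, the complex `Γ_U` is a homology ball of dimension `|U| - 1` whose set of interior faces
is `σ⁻¹(U)`. -/
def IsHomologyTriangulation (k : Type*) [Field k] [Fintype W] [DecidableEq W]
    (T : CarriedComplex W V) : Prop :=
  ∀ U : Finset V, U.Nonempty → ∃ B : SimplComplex W,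
    IsHomologyBall k ((U.card : ℤ) - 1) (T.restrictTo U) B ∧
    ∀ F : Finset W, (F ∈ T.complex ∧ T.carrier F = U) ↔ (F ∈ T.restrictTo U ∧ F ∉ B)

/-- Quasi-geometric: there are no face `F` and `U ⊆ V` such that `dim Γ_U < dim F` while the
carriers of all vertices of `F` lie in `U`. -/
def IsQuasiGeometric (T : CarriedComplex W V) : Prop :=
  ¬ ∃ (F : Finset W) (U : Finset V), F ∈ T.complex ∧
    (T.restrictTo U).dim < (F.card : ℤ) - 1 ∧ ∀ w ∈ F, T.carrier {w} ⊆ U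

end Triangulations

/-! ### Face rings -/

section FaceRings

variable (k : Type*) [Field k] {W : Type*}

/-- The ideal generated by the squarefree monomials `x^F` for the non-faces `F`. -/
def nonfaceIdeal (Δ : SimplComplex W) : Ideal (MvPolynomial W k) :=
  Ideal.span {p | ∃ F : Finset W, F ∉ Δ ∧ p = ∏ w ∈ F, MvPolynomial.X w}

/-- The face ring `k[Δ]`. The variables of non-vertices are zero in it. -/
abbrev FaceRing (Δ : SimplComplex W) : Type _ := MvPolynomial W k ⧸ nonfaceIdeal k Δ

/-- The class of the monomial `x^F` in the face ring. -/
def faceMonomial (Δ : SimplComplex W) (F : Finset W) : FaceRing k Δ :=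
  Ideal.Quotient.mk (nonfaceIdeal k Δ) (∏ w ∈ F, MvPolynomial.X w)

/-- The homogeneous part of degree `i` of the face ring. -/
def gradedPart (Δ : SimplComplex W) (i : ℕ) : Submodule k (FaceRing k Δ) :=
  (MvPolynomial.homogeneousSubmodule W k i).map
    (Ideal.Quotient.mkₐ k (nonfaceIdeal k Δ)).toLinearMap

/-- The homogeneous part of degree `i` of the quotient of the face ring by an ideal `J` (used for
homogeneous `J`). -/
def quotGradedPart (Δ : SimplComplex W) (J : Ideal (FaceRing k Δ)) (i : ℕ) :
    Submodule k (FaceRing k Δ ⧸ J) :=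
  (gradedPart k Δ i).map (Ideal.Quotient.mkₐ k J).toLinearMap

theorem nonfaceIdeal_mono {Δ' Δ : SimplComplex W} (h : Δ' ≤ Δ) :
    nonfaceIdeal k Δ ≤ nonfaceIdeal k Δ' := by
  apply Ideal.span_mono
  rintro p ⟨F, hF, rfl⟩
  exact ⟨F, fun hF' => hF (h F hF'), rfl⟩

/-- The restriction map `k[Δ] → k[Δ']` to a subcomplex: `x^F ↦ x^F` if `F ∈ Δ'`, and
`x^F ↦ 0` otherwise. -/
def restrict {Δ' Δ : SimplComplex W} (h : Δ' ≤ Δ) : FaceRing k Δ →ₐ[k] FaceRing k Δ' :=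
  Ideal.Quotient.factorₐ k (nonfaceIdeal_mono k h)

open Classical in
/-- The `k`-linear endomorphism of the polynomial ring that keeps the monomials supported on faces
of `Δ` and kills the others. -/
def keepFaces (Δ : SimplComplex W) : MvPolynomial W k →ₗ[k] MvPolynomial W k :=
  (MvPolynomial.basisMonomials W k).constr k
    (fun e : W →₀ ℕ => if e.support ∈ Δ then MvPolynomial.monomial e (1 : k) else 0)

open Classical in
theorem keepFaces_monomial (Δ : SimplComplex W) (e : W →₀ ℕ) :
    keepFaces k Δ (MvPolynomial.monomial e (1 : k)) =
      if e.support ∈ Δ then MvPolynomial.monomial e (1 : k) else 0 := by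
  have h := (MvPolynomial.basisMonomials W k).constr_basis k
    (fun e : W →₀ ℕ => if e.support ∈ Δ then MvPolynomial.monomial e (1 : k) else 0) e
  rwa [MvPolynomial.coe_basisMonomials] at h

theorem prod_X_eq_monomial (F : Finset W) :
    (∏ w ∈ F, MvPolynomial.X w : MvPolynomial W k) =
      MvPolynomial.monomial (∑ w ∈ F, Finsupp.single w 1) 1 := by
  rw [MvPolynomial.monomial_sum_one]
  rfl

theorem subset_support_sum (F : Finset W) :
    F ⊆ (∑ w ∈ F, Finsupp.single w 1 : W →₀ ℕ).support := by
  classical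
  intro w hw
  rw [Finsupp.mem_support_iff, Finsupp.finsetSum_apply]
  simp [Finsupp.single_apply, hw]

theorem keepFaces_nonface (Δ : SimplComplex W) (p : MvPolynomial W k)
    (hp : p ∈ nonfaceIdeal k Δ) : keepFaces k Δ p = 0 := by
  classical
  refine Submodule.span_induction (p := fun q _ => ∀ a, keepFaces k Δ (a * q) = 0)
    ?_ ?_ ?_ ?_ hp 1 |> fun h => by simpa using h
  · rintro q ⟨F, hF, rfl⟩ a
    rw [prod_X_eq_monomial]
    induction a using MvPolynomial.induction_on' with
    | monomial e c =>
      have hc : MvPolynomial.monomial e c *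
          MvPolynomial.monomial (∑ w ∈ F, Finsupp.single w 1) (1 : k) =
          c • MvPolynomial.monomial (e + ∑ w ∈ F, Finsupp.single w 1) (1 : k) := by
        rw [MvPolynomial.monomial_mul, MvPolynomial.smul_monomial, smul_eq_mul]
      rw [hc, map_smul, keepFaces_monomial, if_neg, smul_zero]
      intro hmem
      refine hF (Δ.down_closed hmem ((subset_support_sum F).trans ?_))
      intro w hw
      rw [Finsupp.mem_support_iff] at hw ⊢
      rw [Finsupp.add_apply]
      omega
    | add a b ha hb => rw [add_mul, map_add, ha, hb, add_zero]
  · intro a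
    rw [mul_zero, map_zero]
  · intro x y _ _ hx hy a
    rw [mul_add, map_add, hx, hy, add_zero]
  · intro r x _ hx a
    rw [smul_eq_mul, ← mul_assoc]
    exact hx _

/-- The `k`-linear section `k[Δ] → k[x_w : w ∈ W]` that writes an element of the face ring as the
combination of the monomials supported on faces of `Δ`, which form a basis of `k[Δ]`. -/
def normalForm (Δ : SimplComplex W) : FaceRing k Δ →ₗ[k] MvPolynomial W k :=
  ((nonfaceIdeal k Δ).restrictScalars k).liftQ (keepFaces k Δ)
    (fun p hp => keepFaces_nonface k Δ p hp)

theorem normalForm_mk (Δ : SimplComplex W) (p : MvPolynomial W k) :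
    normalForm k Δ (Ideal.Quotient.mk (nonfaceIdeal k Δ) p) = keepFaces k Δ p := rfl

/-- The support of a linear form `θ = ∑ a_w x_w` of `k[Δ]`: the vertices `w` with `a_w ≠ 0`. -/
def supp (Δ : SimplComplex W) (θ : FaceRing k Δ) : Set W :=
  {w | (normalForm k Δ θ).coeff (Finsupp.single w 1) ≠ 0}

/-- The natural inclusion of face rings `k[Δ'] → k[Δ]` for a subcomplex `Δ'` of `Δ`: each monomial
supported on a face of `Δ'` goes to the same monomial. It is `k`-linear; it is multiplicative
if `Δ'` is a full subcomplex. -/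
def faceInclusion {Δ' Δ : SimplComplex W} (_h : Δ' ≤ Δ) : FaceRing k Δ' →ₗ[k] FaceRing k Δ :=
  (Ideal.Quotient.mkₐ k (nonfaceIdeal k Δ)).toLinearMap ∘ₗ normalForm k Δ'

theorem mk_monomial_eq_zero (Δ : SimplComplex W) (e : W →₀ ℕ) (he : e.support ∉ Δ) :
    Ideal.Quotient.mk (nonfaceIdeal k Δ) (MvPolynomial.monomial e (1 : k)) = 0 := by
  classical
  rw [Ideal.Quotient.eq_zero_iff_mem]
  have hle : (∑ w ∈ e.support, Finsupp.single w 1 : W →₀ ℕ) ≤ e := by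
    intro w
    rw [Finsupp.finsetSum_apply]
    by_cases hw : e w = 0
    · simp [Finsupp.single_apply, hw]
    · simp [Finsupp.single_apply, hw]
      omega
  have : MvPolynomial.monomial e (1 : k) =
      MvPolynomial.monomial (e - ∑ w ∈ e.support, Finsupp.single w 1) 1 *
        ∏ w ∈ e.support, MvPolynomial.X w := by
    rw [prod_X_eq_monomial, MvPolynomial.monomial_mul, tsub_add_cancel_of_le hle, one_mul]
  rw [this]
  exact Ideal.mul_mem_left _ _ (Ideal.subset_span ⟨_, he, rfl⟩)

open Classical in
theorem faceInclusion_monomial {Δ' Δ : SimplComplex W} (h : Δ' ≤ Δ) (e : W →₀ ℕ) :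
    faceInclusion k h (Ideal.Quotient.mk (nonfaceIdeal k Δ') (MvPolynomial.monomial e (1 : k))) =
      if e.support ∈ Δ' then
        Ideal.Quotient.mk (nonfaceIdeal k Δ) (MvPolynomial.monomial e (1 : k)) else 0 := by
  change Ideal.Quotient.mk (nonfaceIdeal k Δ)
    (keepFaces k Δ' (MvPolynomial.monomial e (1 : k))) = _
  rw [keepFaces_monomial]
  split_ifs
  · rfl
  · exact map_zero _

theorem faceInclusion_one {Δ' Δ : SimplComplex W} (h : Δ' ≤ Δ) : faceInclusion k h 1 = 1 := by
  have := faceInclusion_monomial k h 0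
  rw [Finsupp.support_zero] at this
  exact this.trans (if_pos Δ'.empty_mem)

theorem faceInclusion_mul {Δ' Δ : SimplComplex W} (h : IsFull Δ' Δ) (x y : FaceRing k Δ') :
    faceInclusion k h.1 (x * y) = faceInclusion k h.1 x * faceInclusion k h.1 y := by
  classical
  obtain ⟨p, rfl⟩ := Ideal.Quotient.mk_surjective x
  obtain ⟨q, rfl⟩ := Ideal.Quotient.mk_surjective y
  have smul_mk : ∀ (c : k) (r : MvPolynomial W k),
      Ideal.Quotient.mk (nonfaceIdeal k Δ') (c • r) =
        c • Ideal.Quotient.mk (nonfaceIdeal k Δ') r := fun c r => rfl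
  have mono_eq : ∀ (e : W →₀ ℕ) (c : k), MvPolynomial.monomial e c =
      c • MvPolynomial.monomial e (1 : k) := fun e c => by
    rw [MvPolynomial.smul_monomial, smul_eq_mul, mul_one]
  induction p using MvPolynomial.induction_on' with
  | add a b ha hb => rw [map_add, add_mul, map_add, ha, hb, map_add, add_mul]
  | monomial e c =>
    induction q using MvPolynomial.induction_on' with
    | add a b ha hb => rw [map_add, mul_add, map_add, ha, hb, map_add, mul_add]
    | monomial f c' =>
      rw [mono_eq e c, mono_eq f c', smul_mk, smul_mk, smul_mul_smul_comm, map_smul, map_smul,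
        map_smul, smul_mul_smul_comm]
      congr 1
      rw [← map_mul, MvPolynomial.monomial_mul, one_mul, faceInclusion_monomial,
        faceInclusion_monomial, faceInclusion_monomial]
      have hs : (e + f).support = e.support ∪ f.support := by
        ext w
        simp only [Finsupp.mem_support_iff, Finsupp.add_apply, Finset.mem_union]
        omega
      have hprod : Ideal.Quotient.mk (nonfaceIdeal k Δ) (MvPolynomial.monomial (e + f) (1 : k)) =
          Ideal.Quotient.mk (nonfaceIdeal k Δ) (MvPolynomial.monomial e (1 : k)) *
          Ideal.Quotient.mk (nonfaceIdeal k Δ) (MvPolynomial.monomial f (1 : k)) := by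
        rw [← map_mul, MvPolynomial.monomial_mul, one_mul]
      by_cases he : e.support ∈ Δ'
      · by_cases hf : f.support ∈ Δ'
        · rw [if_pos he, if_pos hf]
          by_cases hef : (e + f).support ∈ Δ'
          · rw [if_pos hef, hprod]
          · rw [if_neg hef, ← hprod, mk_monomial_eq_zero]
            intro hmem
            refine hef (h.2 _ hmem fun w hw => ?_)
            rw [hs, Finset.mem_union] at hw
            rcases hw with hw | hw
            · exact Δ'.down_closed he (Finset.singleton_subset_iff.2 hw)
            · exact Δ'.down_closed hf (Finset.singleton_subset_iff.2 hw)
        · rw [if_neg hf, mul_zero, if_neg]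
          intro hmem
          exact hf (Δ'.down_closed hmem (hs ▸ Finset.subset_union_right))
      · rw [if_neg he, zero_mul, if_neg]
        intro hmem
        exact he (Δ'.down_closed hmem (hs ▸ Finset.subset_union_left))

/-- For a full subcomplex the natural inclusion of face rings is a homomorphism of `k`-algebras. -/
def fullInclusion {Δ' Δ : SimplComplex W} (h : IsFull Δ' Δ) : FaceRing k Δ' →ₐ[k] FaceRing k Δ :=
  AlgHom.ofLinearMap (faceInclusion k h.1) (faceInclusion_one k h.1) (faceInclusion_mul k h)

/-- A linear system of parameters of length `d` for the face ring `k[Δ]`: the Krull dimension of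
`k[Δ]` is `d`, each `θ i` has degree one, and `k[Δ]/(θ)` is finite-dimensional. -/
def IsLSOP (Δ : SimplComplex W) {d : ℕ} (θ : Fin d → FaceRing k Δ) : Prop :=
  ringKrullDim (FaceRing k Δ) = (d : WithBot ℕ∞) ∧
  (∀ i, θ i ∈ gradedPart k Δ 1) ∧
  FiniteDimensional k (FaceRing k Δ ⧸ Ideal.span (Set.range θ))

end FaceRings

/-! ### Special l.s.o.p.s and local face modules -/

section LocalFaceModules

variable (k : Type*) [Field k] {W V : Type*} [DecidableEq W]

/-- The link of `E` in the triangulating complex. -/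
abbrev CarriedComplex.lk (T : CarriedComplex W V) (E : Finset W) (hE : E ∈ T.complex) :
    SimplComplex W :=
  T.complex.link E hE

/-- `τ` assigns to the vertices `v ∈ V` outside `σ(E)` distinct members `θ_v = θ (τ v)` of the
sequence `θ`, such that the support of `θ_v` consists of vertices of the link of `E` whose carrier
contains `v`. -/
def IsSpecialLabelling (T : CarriedComplex W V) (E : Finset W) (hE : E ∈ T.complex) {d : ℕ}
    (θ : Fin d → FaceRing k (T.lk E hE)) (τ : {v : V // v ∉ T.carrier E} → Fin d) : Prop :=
  Function.Injective τ ∧ ∀ v : {v : V // v ∉ T.carrier E},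
    supp k (T.lk E hE) (θ (τ v)) ⊆
      {w | ({w} : Finset W) ∈ T.lk E hE ∧ (v : V) ∈ T.carrier {w}}

/-- A special l.s.o.p. for the face ring of the link of `E`. -/
def IsSpecialLSOP (T : CarriedComplex W V) (E : Finset W) (hE : E ∈ T.complex) {d : ℕ}
    (θ : Fin d → FaceRing k (T.lk E hE)) : Prop :=
  IsLSOP k (T.lk E hE) θ ∧
    ∃ τ : {v : V // v ∉ T.carrier E} → Fin d, IsSpecialLabelling k T E hE θ τ

/-- The ideal of `k[lk(E)]` generated by the `x^F` with `F` in the link and `F ⊔ E` interior. -/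
def interiorIdeal [Fintype V] (T : CarriedComplex W V) (E : Finset W) (hE : E ∈ T.complex) :
    Ideal (FaceRing k (T.lk E hE)) :=
  Ideal.span {x | ∃ F : Finset W, F ∈ T.lk E hE ∧ T.carrier (F ∪ E) = Finset.univ ∧
    x = faceMonomial k (T.lk E hE) F}

/-- The local face module `L(Γ, E)`: the image of the interior ideal in `k[lk(E)]/(θ)`. -/
def localFaceModule [Fintype V] (T : CarriedComplex W V) (E : Finset W) (hE : E ∈ T.complex)
    {d : ℕ} (θ : Fin d → FaceRing k (T.lk E hE)) :
    Ideal (FaceRing k (T.lk E hE) ⧸ Ideal.span (Set.range θ)) :=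
  (interiorIdeal k T E hE).map (Ideal.Quotient.mk (Ideal.span (Set.range θ)))

/-- The ideal `k[lk(E')] ∩ (θ'₁, …, θ'_d)` of `k[lk(E')]`, where `θ'ᵢ` is the restriction of `θᵢ`
to the closed star of `E' \ E` in the link of `E`, and `k[lk(E')]` is identified with a subalgebra
of the face ring of that star. -/
def contractedIdeal (T : CarriedComplex W V) {E E' : Finset W} (hE : E ∈ T.complex)
    (hE' : E' ∈ T.complex) (h : E ⊆ E') {d : ℕ} (θ : Fin d → FaceRing k (T.lk E hE)) :
    Ideal (FaceRing k (T.lk E' hE')) :=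
  (Ideal.span (Set.range fun i => restrict k (starIn_le T.complex hE hE' h) (θ i))).comap
    (fullInclusion k (link_full_starIn T.complex hE hE' h))

/-- `φ` is a homomorphism of graded `k[lk(E')]`-algebras from `k[lk(E)]/(θ)` to
`k[lk(E')]/(k[lk(E')] ∩ (θ'))` that kills `[x^F]` for each face `F` of the link of `E` outside the
closed star of `E' \ E`. Here `r ∈ k[lk(E')]` acts on `k[lk(E)]/(θ)` as multiplication by the class
of its image under the natural inclusion `k[lk(E')] → k[lk(E)]`. -/
structure IsTransferMap (T : CarriedComplex W V) {E E' : Finset W} (hE : E ∈ T.complex)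
    (hE' : E' ∈ T.complex) (h : E ⊆ E') {d : ℕ} (θ : Fin d → FaceRing k (T.lk E hE))
    (φ : (FaceRing k (T.lk E hE) ⧸ Ideal.span (Set.range θ)) →ₐ[k]
      (FaceRing k (T.lk E' hE') ⧸ contractedIdeal k T hE hE' h θ)) : Prop where
  graded : ∀ (i : ℕ), ∀ x ∈ quotGradedPart k (T.lk E hE) (Ideal.span (Set.range θ)) i,
    φ x ∈ quotGradedPart k (T.lk E' hE') (contractedIdeal k T hE hE' h θ) i
  linear : ∀ (r : FaceRing k (T.lk E' hE'))
      (y : FaceRing k (T.lk E hE) ⧸ Ideal.span (Set.range θ)),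
    φ (Ideal.Quotient.mk _ (faceInclusion k (link_le_link T.complex hE hE' h) r) * y) = r • φ y
  kills : ∀ F : Finset W, F ∈ T.lk E hE → F ∉ starIn T.complex hE hE' h →
    φ (Ideal.Quotient.mk _ (faceMonomial k (T.lk E hE) F)) = 0

/-- A vertex outside `σ(E')` is outside `σ(E)` when `E ⊆ E'`. -/
def outsideVertex (T : CarriedComplex W V) {E E' : Finset W} (hE' : E' ∈ T.complex) (h : E ⊆ E')
    (v : {v : V // v ∉ T.carrier E'}) : {v : V // v ∉ T.carrier E} :=
  ⟨v.1, fun hv => v.2 (T.carrier_mono hE' h hv)⟩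

end LocalFaceModules

end LocalFace

end

open LocalFace

/-! Put D = E' \ E. The closed star of D in lk(E) is the join of lk(E') with the simplex on D, so
its face ring is the polynomial ring over k[lk(E')] in the variables x_w, w ∈ D. The transfer map
restricts to the star and then eliminates these variables by means of the θ'_i.

Elimination is possible because the coefficient vectors of the θ_i on the face D span k^D
(`span_linCoeff_eq_top`): otherwise the common zero locus of the θ_i would contain a line. A set R
of |D| forms whose vectors are a basis can then be solved for the x_w, giving linear forms g_w in
k[lk(E')] with x_w ≡ g_w modulo (θ') (`exists_substitution`). The substitution x_w ↦ g_w is a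
retraction onto k[lk(E')] that is the identity modulo (θ'). Hence J is generated by the images of
the θ_i (`contractedIdeal_eq_span`), and the forms in R go to 0, which leaves the d' forms ζ. The
same congruence forces every transfer map to be induced by the substitution
(`IsTransferMap.apply_mk`), which gives uniqueness.

If v ∉ σ(E'), no vertex of E' has v in its carrier, so θ_v has zero coefficients on D. It is
therefore not in R, and substitution only restricts it to lk(E'); so labels and supports carry over.
That ζ has the right length for an l.s.o.p. comes from the dimension of links in homology balls and
from the equality of the Krull dimension of k[Δ] with dim Δ + 1. -/

noncomputable section

namespace LocalFace

/-! ### The face ring as a quotient of the polynomial ring -/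

section FaceRingBasics

variable (k : Type*) [Field k] {W : Type*}

/-- The class of a variable in the face ring. -/
def faceVar (Δ : SimplComplex W) (w : W) : FaceRing k Δ :=
  Ideal.Quotient.mk (nonfaceIdeal k Δ) (MvPolynomial.X w)

theorem faceMonomial_eq_prod (Δ : SimplComplex W) (F : Finset W) :
    faceMonomial k Δ F = ∏ w ∈ F, faceVar k Δ w :=
  map_prod _ _ _

theorem faceMonomial_eq_zero {Δ : SimplComplex W} {F : Finset W} (hF : F ∉ Δ) :
    faceMonomial k Δ F = 0 :=
  Ideal.Quotient.eq_zero_iff_mem.2 (Ideal.subset_span ⟨F, hF, rfl⟩)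

theorem faceVar_eq_zero {Δ : SimplComplex W} {w : W} (hw : ({w} : Finset W) ∉ Δ) :
    faceVar k Δ w = 0 := by
  simpa [faceMonomial_eq_prod] using faceMonomial_eq_zero k hw

variable {k}

/-- The universal property of the face ring. -/
def faceLift {A : Type*} [CommRing A] [Algebra k A] (Δ : SimplComplex W) (f : W → A)
    (hf : ∀ F : Finset W, F ∉ Δ → ∏ w ∈ F, f w = 0) : FaceRing k Δ →ₐ[k] A :=
  Ideal.Quotient.liftₐ (nonfaceIdeal k Δ) (MvPolynomial.aeval f) (by
    intro p hp
    have : nonfaceIdeal k Δ ≤ RingHom.ker (MvPolynomial.aeval (R := k) f) := by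
      rw [nonfaceIdeal, Ideal.span_le]
      rintro _ ⟨F, hF, rfl⟩
      simpa [RingHom.mem_ker, map_prod] using hf F hF
    exact this hp)

@[simp]
theorem faceLift_faceVar {A : Type*} [CommRing A] [Algebra k A] (Δ : SimplComplex W) (f : W → A)
    (hf : ∀ F : Finset W, F ∉ Δ → ∏ w ∈ F, f w = 0) (w : W) :
    faceLift (k := k) Δ f hf (faceVar k Δ w) = f w :=
  MvPolynomial.aeval_X f w

theorem faceRing_algHom_ext {A : Type*} [Semiring A] [Algebra k A] {Δ : SimplComplex W}
    {f g : FaceRing k Δ →ₐ[k] A} (h : ∀ w, f (faceVar k Δ w) = g (faceVar k Δ w)) : f = g :=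
  Ideal.Quotient.algHom_ext _ (MvPolynomial.algHom_ext h)

end FaceRingBasics

/-! ### The Krull dimension of a face ring -/

section KrullDim

variable (k : Type*) [Field k] {W : Type*}

/-- Killing the variables outside F maps the face ring onto a polynomial ring in |F| variables. This
is well defined because a non-face cannot be contained in F. -/
theorem card_le_ringKrullDim {Δ : SimplComplex W} {F : Finset W} (hF : F ∈ Δ) :
    ((F.card : ℕ) : WithBot ℕ∞) ≤ ringKrullDim (FaceRing k Δ) := by
  classical
  let g : FaceRing k Δ →ₐ[k] MvPolynomial F k :=
    faceLift Δ (fun w => if h : w ∈ F then MvPolynomial.X ⟨w, h⟩ else 0) (by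
      intro G hG
      obtain ⟨w, hw, hwF⟩ := Finset.not_subset.1 fun h => hG (Δ.down_closed hF h)
      exact Finset.prod_eq_zero hw (dif_neg hwF))
  have hg : Function.Surjective g := by
    rw [← AlgHom.range_eq_top, eq_top_iff, ← MvPolynomial.adjoin_range_X, Algebra.adjoin_le_iff]
    rintro _ ⟨w, rfl⟩
    exact ⟨faceVar k Δ w, by simp [g]⟩
  have := ringKrullDim_le_of_surjective g.toRingHom hg
  rw [MvPolynomial.ringKrullDim_of_isNoetherianRing, ringKrullDim_eq_zero_of_field] at this
  simpa using this

/-- The variables outside a prime P form a face, since a non-face monomial is 0 and so has a factor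
in P. Thus the quotient by P is an image of a polynomial ring in at most n variables. -/
theorem ringKrullDim_quotient_prime_le [Fintype W] {Δ : SimplComplex W} {n : ℕ}
    (hn : ∀ F ∈ Δ, F.card ≤ n) (P : Ideal (FaceRing k Δ)) [P.IsPrime] :
    ringKrullDim (FaceRing k Δ ⧸ P) ≤ (n : WithBot ℕ∞) := by
  classical
  let F : Finset W := Finset.univ.filter fun w => faceVar k Δ w ∉ P
  have hF : F ∈ Δ := by
    by_contra h
    have h0 : ∏ w ∈ F, faceVar k Δ w ∈ P := by
      rw [← faceMonomial_eq_prod, faceMonomial_eq_zero k h]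
      exact P.zero_mem
    obtain ⟨w, hw, hwP⟩ := (Ideal.IsPrime.prod_mem_iff).1 h0
    exact (Finset.mem_filter.1 hw).2 hwP
  let g : MvPolynomial F k →ₐ[k] FaceRing k Δ ⧸ P :=
    MvPolynomial.aeval fun w : F => Ideal.Quotient.mk P (faceVar k Δ w)
  have hg : Function.Surjective g := by
    intro y
    obtain ⟨y, rfl⟩ := Ideal.Quotient.mk_surjective y
    obtain ⟨p, rfl⟩ := Ideal.Quotient.mk_surjective y
    change Ideal.Quotient.mkₐ k P (Ideal.Quotient.mkₐ k _ p) ∈ g.range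
    induction p using MvPolynomial.induction_on with
    | C a =>
      rw [← MvPolynomial.algebraMap_eq, AlgHom.commutes, AlgHom.commutes]
      exact g.range.algebraMap_mem a
    | add p q hp hq => rw [map_add, map_add]; exact add_mem hp hq
    | mul_X p w hp =>
      rw [map_mul, map_mul]
      refine mul_mem hp ?_
      by_cases hw : w ∈ F
      · exact ⟨MvPolynomial.X ⟨w, hw⟩, by simp only [g]; exact MvPolynomial.aeval_X _ _⟩
      · have : faceVar k Δ w ∈ P := by simpa [F] using hw
        have h0 : Ideal.Quotient.mkₐ k P (Ideal.Quotient.mkₐ k _ (MvPolynomial.X w)) = 0 :=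
          Ideal.Quotient.eq_zero_iff_mem.2 this
        rw [h0]
        exact zero_mem _
  refine (ringKrullDim_le_of_surjective g.toRingHom hg).trans ?_
  rw [MvPolynomial.ringKrullDim_of_isNoetherianRing, ringKrullDim_eq_zero_of_field, zero_add,
    Nat.card_eq_fintype_card, Fintype.card_coe]
  exact_mod_cast hn F hF

theorem ringKrullDim_faceRing_le [Fintype W] {Δ : SimplComplex W} {n : ℕ}
    (hn : ∀ F ∈ Δ, F.card ≤ n) : ringKrullDim (FaceRing k Δ) ≤ (n : WithBot ℕ∞) := by
  rw [ringKrullDim, Order.krullDim_eq_iSup_coheight]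
  refine iSup_le fun P => ?_
  have h := ringKrullDim_quotient_prime_le k hn P.asIdeal
  rw [ringKrullDim_quotient] at h
  rw [Order.coheight_eq_krullDim_Ici]
  exact h

theorem bddAbove_card_faces [Fintype W] (Δ : SimplComplex W) :
    BddAbove (Finset.card '' Δ.faces) :=
  ⟨Fintype.card W, by rintro _ ⟨F, -, rfl⟩; exact F.card_le_univ⟩

theorem card_le_of_dim_eq [Fintype W] {Δ : SimplComplex W} {n : ℕ} (h : Δ.dim = (n : ℤ) - 1)
    {F : Finset W} (hF : F ∈ Δ) : F.card ≤ n := by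
  have := le_csSup (bddAbove_card_faces Δ) (Set.mem_image_of_mem Finset.card hF)
  unfold SimplComplex.dim at h
  omega

theorem ringKrullDim_eq_of_dim_eq [Fintype W] {Δ : SimplComplex W} {n : ℕ}
    (h : Δ.dim = (n : ℤ) - 1) : ringKrullDim (FaceRing k Δ) = (n : WithBot ℕ∞) := by
  refine le_antisymm (ringKrullDim_faceRing_le k fun F hF => card_le_of_dim_eq h hF) ?_
  obtain ⟨F, hF, hFn⟩ := Nat.sSup_mem ⟨_, Set.mem_image_of_mem Finset.card Δ.empty_mem⟩
    (bddAbove_card_faces Δ)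
  have : F.card = n := by
    unfold SimplComplex.dim at h
    omega
  exact this ▸ card_le_ringKrullDim k hF

end KrullDim

/-! ### Dimensions of links in homology triangulations -/

section Links

theorem link_empty_dim {W : Type*} [DecidableEq W] (Δ : SimplComplex W) :
    (Δ.link ∅ Δ.empty_mem).dim = Δ.dim := by
  have : (Δ.link ∅ Δ.empty_mem).faces = Δ.faces := by
    ext F
    change Disjoint F ∅ ∧ F ∪ ∅ ∈ Δ.faces ↔ _
    simp
  rw [SimplComplex.dim, this, SimplComplex.dim]

variable {k : Type*} [Field k] {W V : Type*} [Fintype W] [DecidableEq W]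

theorem IsHomologyBall.dim_eq' {d : ℤ} {Δ B : SimplComplex W} (h : IsHomologyBall k d Δ B) :
    Δ.dim = d := by
  cases h
  assumption

/-- Links are spheres or balls of this dimension by definition. The empty face is treated apart,
since the definition makes links of boundary faces balls only for nonempty faces. -/
theorem IsHomologyBall.link_dim {d : ℤ} {Δ B : SimplComplex W} (h : IsHomologyBall k d Δ B)
    {F : Finset W} (hF : F ∈ Δ) : (Δ.link F hF).dim = d - F.card := by
  rcases F.eq_empty_or_nonempty with rfl | hne
  · rw [link_empty_dim, h.dim_eq']
    simp
  · cases h with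
    | mk _ _ _ _ dim_eq _ _ _ hint hbd =>
      by_cases hB : F ∈ B
      · exact (hbd F hF hB hne).dim_eq'
      · exact (hint F hF hB).1

/-- F lies in the ball over its own carrier. This makes the natural number subtraction |V| - |F| a
genuine one. -/
theorem card_le_card_carrier {T : CarriedComplex W V} (hT : IsHomologyTriangulation k T)
    {F : Finset W} (hF : F ∈ T.complex) : F.card ≤ (T.carrier F).card := by
  rcases (T.carrier F).eq_empty_or_nonempty with h | h
  · rw [(T.carrier_eq_empty F hF).1 h]
    simp
  · obtain ⟨B, hB, -⟩ := hT _ h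
    exact card_le_of_dim_eq hB.dim_eq' ⟨hF, subset_rfl⟩

theorem link_dim_eq [Fintype V] {T : CarriedComplex W V} (hT : IsHomologyTriangulation k T)
    {F : Finset W} (hF : F ∈ T.complex) :
    (T.lk F hF).dim = ((Fintype.card V - F.card : ℕ) : ℤ) - 1 := by
  have hc : F.card ≤ Fintype.card V := (card_le_card_carrier hT hF).trans (Finset.card_le_univ _)
  -- The ball condition only concerns nonempty U; for empty V the complex is {∅}, of dimension -1.
  rcases isEmpty_or_nonempty V with hV | hV
  · have h0 : ∀ G ∈ T.complex, G = ∅ := fun G hG =>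
      (T.carrier_eq_empty G hG).1 (Finset.eq_empty_of_isEmpty _)
    have : Finset.card '' (T.lk F hF).faces = {0} := by
      ext m
      constructor
      · rintro ⟨G, hG, rfl⟩
        have := h0 G (T.complex.down_closed hG.2 Finset.subset_union_left)
        simp [this]
      · rintro rfl
        exact ⟨∅, (T.lk F hF).empty_mem, rfl⟩
    rw [SimplComplex.dim, this]
    simp
  · obtain ⟨B, hB, -⟩ := hT Finset.univ Finset.univ_nonempty
    have hF' : F ∈ T.restrictTo Finset.univ := ⟨hF, Finset.subset_univ _⟩
    have h := hB.link_dim hF'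
    have hfaces : ((T.restrictTo Finset.univ).link F hF').faces = (T.lk F hF).faces := by
      ext G
      exact ⟨fun h => ⟨h.1, h.2.1⟩, fun h => ⟨h.1, h.2, Finset.subset_univ _⟩⟩
    rw [SimplComplex.dim, hfaces] at h
    rw [SimplComplex.dim, h, Finset.card_univ]
    omega

end Links

/-! ### Linear forms -/

section LinearForms

variable {k : Type*} [Field k] {W : Type*}

/-- The coefficient of `x_w` in a linear form of the face ring. -/
def linCoeff (Δ : SimplComplex W) (θ : FaceRing k Δ) (w : W) : k :=
  (normalForm k Δ θ).coeff (Finsupp.single w 1)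

theorem faceVar_mem_gradedPart (Δ : SimplComplex W) (w : W) :
    faceVar k Δ w ∈ gradedPart k Δ 1 :=
  ⟨MvPolynomial.X w, MvPolynomial.isHomogeneous_X k w, rfl⟩

theorem gradedPart_one_eq_span (Δ : SimplComplex W) :
    gradedPart k Δ 1 = Submodule.span k (Set.range (faceVar k Δ)) := by
  rw [gradedPart, MvPolynomial.homogeneousSubmodule_one_eq_span_X, Submodule.map_span,
    ← Set.range_comp]
  rfl

open Classical in
theorem linCoeff_faceVar (Δ : SimplComplex W) (u w : W) :
    linCoeff Δ (faceVar k Δ u) w = if ({u} : Finset W) ∈ Δ ∧ u = w then 1 else 0 := by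
  have h : normalForm k Δ (faceVar k Δ u) = _ := keepFaces_monomial k Δ (Finsupp.single u 1)
  rw [linCoeff, h, Finsupp.support_single u one_ne_zero]
  by_cases hu : ({u} : Finset W) ∈ Δ
  · simp [hu, MvPolynomial.coeff_monomial, Finsupp.single_left_inj (one_ne_zero (α := ℕ))]
  · simp [hu]

theorem eq_sum_linCoeff [Fintype W] {Δ : SimplComplex W} {θ : FaceRing k Δ}
    (hθ : θ ∈ gradedPart k Δ 1) : θ = ∑ w, linCoeff Δ θ w • faceVar k Δ w := by
  classical
  rw [gradedPart_one_eq_span] at hθ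
  induction hθ using Submodule.span_induction with
  | mem x hx =>
    obtain ⟨u, rfl⟩ := hx
    simp only [linCoeff_faceVar]
    by_cases hu : ({u} : Finset W) ∈ Δ
    · simp [hu]
    · simp [hu, faceVar_eq_zero k hu]
  | zero => simp [linCoeff]
  | add x y _ _ hx hy =>
    nth_rewrite 1 [hx, hy]
    simp [linCoeff, add_smul, Finset.sum_add_distrib]
  | smul a x _ hx =>
    nth_rewrite 1 [hx]
    simp [linCoeff, Finset.smul_sum, mul_smul]

theorem linCoeff_sum [Fintype W] (Δ : SimplComplex W) (c : W → k) {w : W}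
    (hw : ({w} : Finset W) ∈ Δ) : linCoeff Δ (∑ u, c u • faceVar k Δ u) w = c w := by
  classical
  have h : linCoeff Δ (∑ u, c u • faceVar k Δ u) w =
      ∑ u, c u * linCoeff Δ (faceVar k Δ u) w := by
    simp [linCoeff, MvPolynomial.coeff_sum]
  rw [h, Finset.sum_eq_single w]
  · simp [linCoeff_faceVar, hw]
  · intro u _ hu
    simp [linCoeff_faceVar, hu]
  · simp

theorem linCoeff_eq_zero [Fintype W] {Δ : SimplComplex W} {θ : FaceRing k Δ}
    (hθ : θ ∈ gradedPart k Δ 1) {w : W} (hw : ({w} : Finset W) ∉ Δ) : linCoeff Δ θ w = 0 := by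
  classical
  rw [eq_sum_linCoeff hθ]
  have h : ∀ c : W → k, linCoeff Δ (∑ u, c u • faceVar k Δ u) w =
      ∑ u, c u * linCoeff Δ (faceVar k Δ u) w := fun c => by
    simp [linCoeff, MvPolynomial.coeff_sum]
  rw [h]
  refine Finset.sum_eq_zero fun u _ => ?_
  rw [linCoeff_faceVar, if_neg, mul_zero]
  rintro ⟨hu, rfl⟩
  exact hw hu

/-- An algebra homomorphism between face rings that sends variables to linear forms preserves
degrees. -/
theorem map_gradedPart_of_faceVar {W' : Type*} {Δ : SimplComplex W} {Δ' : SimplComplex W'}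
    (f : FaceRing k Δ →ₐ[k] FaceRing k Δ') (hf : ∀ w, f (faceVar k Δ w) ∈ gradedPart k Δ' 1)
    {i : ℕ} {x : FaceRing k Δ} (hx : x ∈ gradedPart k Δ i) : f x ∈ gradedPart k Δ' i := by
  choose q hq hqf using hf
  obtain ⟨p, hp, rfl⟩ := hx
  refine ⟨MvPolynomial.aeval q p, by simpa using MvPolynomial.IsHomogeneous.aeval hp q hq, ?_⟩
  have : (Ideal.Quotient.mkₐ k (nonfaceIdeal k Δ')).comp (MvPolynomial.aeval q) =
      f.comp (Ideal.Quotient.mkₐ k (nonfaceIdeal k Δ)) :=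
    MvPolynomial.algHom_ext fun w => by
      rw [AlgHom.comp_apply, MvPolynomial.aeval_X]
      exact hqf w
  exact DFunLike.congr_fun this p

/-- If finitely many linear forms generate an ideal of finite codimension, then their coefficient
vectors on any face span the coordinate space. -/
theorem span_linCoeff_eq_top [Fintype W] {Δ : SimplComplex W} {ι : Type*} [Finite ι]
    {θ : ι → FaceRing k Δ} (hθ : ∀ i, θ i ∈ gradedPart k Δ 1)
    [FiniteDimensional k (FaceRing k Δ ⧸ Ideal.span (Set.range θ))] {D : Finset W} (hD : D ∈ Δ) :
    Submodule.span k (Set.range fun (i : ι) (w : D) => linCoeff Δ (θ i) w) = ⊤ := by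
  classical
  by_contra hne
  -- A nonzero functional vanishing on all coefficient vectors is a point a ≠ 0 supported on D where
  -- every θ i vanishes. Restricting functions to the line t ↦ t·a maps the quotient ring onto k[t],
  -- which is not finite-dimensional.
  obtain ⟨φ, hφ0, hφ⟩ := Submodule.exists_le_ker_of_lt_top _ (lt_top_iff_ne_top.2 hne)
  let a : W → k := fun w => if h : w ∈ D then φ (Pi.single ⟨w, h⟩ 1) else 0
  let g : FaceRing k Δ →ₐ[k] Polynomial k :=
    faceLift Δ (fun w => a w • Polynomial.X) (by
      intro G hG
      obtain ⟨w, hw, hwD⟩ := Finset.not_subset.1 fun h => hG (Δ.down_closed hD h)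
      exact Finset.prod_eq_zero hw (by simp [a, hwD]))
  have hφa : ∀ c : W → k, ∑ w, c w * a w = φ fun w : D => c w := by
    intro c
    rw [← Finset.sum_subset (Finset.subset_univ D) (fun w _ hw => by simp [a, hw]),
      ← Finset.sum_coe_sort]
    conv_rhs => rw [pi_eq_sum_univ' (fun w : D => c w)]
    simp [a]
  have hg0 : ∀ i, g (θ i) = 0 := by
    intro i
    rw [eq_sum_linCoeff (hθ i), map_sum]
    simp only [map_smul, g, faceLift_faceVar, smul_smul, ← Finset.sum_smul]
    rw [hφa, show φ (fun w : D => linCoeff Δ (θ i) w) = 0 from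
      hφ (Submodule.subset_span ⟨i, rfl⟩), zero_smul]
  have hgs : Function.Surjective g := by
    obtain ⟨w, hw⟩ : ∃ w, a w ≠ 0 := by
      by_contra! h
      refine hφ0 (LinearMap.pi_ext' fun w => LinearMap.ext_ring ?_)
      simpa [a] using h w
    rw [← AlgHom.range_eq_top, eq_top_iff, ← Polynomial.adjoin_X, Algebra.adjoin_le_iff]
    rintro _ rfl
    exact ⟨(a w)⁻¹ • faceVar k Δ w, by simp [g, smul_smul, hw]⟩
  let h := Ideal.Quotient.liftₐ (Ideal.span (Set.range θ)) g (fun x hx => by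
    have : Ideal.span (Set.range θ) ≤ RingHom.ker g :=
      Ideal.span_le.2 (by rintro _ ⟨i, rfl⟩; exact hg0 i)
    exact this hx)
  have hh : Function.Surjective h := fun y => by
    obtain ⟨x, rfl⟩ := hgs y
    exact ⟨Ideal.Quotient.mk _ x, rfl⟩
  exact Polynomial.not_finite (R := k) (Module.Finite.of_surjective h.toLinearMap hh)

end LinearForms

/-! ### Functoriality of face rings -/

section Functoriality

variable {k : Type*} [Field k] {W : Type*}

@[simp]
theorem restrict_faceVar {Δ' Δ : SimplComplex W} (h : Δ' ≤ Δ) (w : W) :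
    restrict k h (faceVar k Δ w) = faceVar k Δ' w :=
  rfl

theorem restrict_surjective {Δ' Δ : SimplComplex W} (h : Δ' ≤ Δ) :
    Function.Surjective (restrict k h) :=
  Ideal.Quotient.factor_surjective (nonfaceIdeal_mono k h)

theorem restrict_faceMonomial {Δ' Δ : SimplComplex W} (h : Δ' ≤ Δ) (F : Finset W) :
    restrict k h (faceMonomial k Δ F) = faceMonomial k Δ' F :=
  rfl

theorem restrict_faceInclusion {Δ'' Δ' Δ : SimplComplex W} (h : Δ' ≤ Δ) (h' : Δ'' ≤ Δ')
    (h'' : Δ'' ≤ Δ) (x : FaceRing k Δ'') :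
    restrict k h (faceInclusion k h'' x) = faceInclusion k h' x := by
  obtain ⟨p, rfl⟩ := Ideal.Quotient.mk_surjective x
  rfl

/-- The kernel of the restriction map is generated by the monomials of the missing faces. -/
theorem ker_restrict_le {Δ' Δ : SimplComplex W} (h : Δ' ≤ Δ) {I : Ideal (FaceRing k Δ)}
    (hI : ∀ F : Finset W, F ∈ Δ → F ∉ Δ' → faceMonomial k Δ F ∈ I) :
    RingHom.ker (restrict k h) ≤ I := by
  intro x hx
  obtain ⟨p, rfl⟩ := Ideal.Quotient.mk_surjective x
  have hp : p ∈ nonfaceIdeal k Δ' := Ideal.Quotient.eq_zero_iff_mem.1 hx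
  have hle : nonfaceIdeal k Δ' ≤ I.comap (Ideal.Quotient.mk (nonfaceIdeal k Δ)) := by
    refine Ideal.span_le.2 ?_
    rintro _ ⟨F, hF, rfl⟩
    change faceMonomial k Δ F ∈ I
    by_cases hFΔ : F ∈ Δ
    · exact hI F hFΔ hF
    · rw [faceMonomial_eq_zero k hFΔ]
      exact I.zero_mem
  exact hle hp

theorem faceInclusion_faceVar {Δ' Δ : SimplComplex W} (h : Δ' ≤ Δ) {w : W}
    (hw : ({w} : Finset W) ∈ Δ') : faceInclusion k h (faceVar k Δ' w) = faceVar k Δ w := by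
  classical
  have := faceInclusion_monomial k h (Finsupp.single w 1)
  rw [Finsupp.support_single w one_ne_zero, if_pos hw] at this
  exact this

theorem linCoeff_restrict [Fintype W] {Δ' Δ : SimplComplex W} (h : Δ' ≤ Δ) {θ : FaceRing k Δ}
    (hθ : θ ∈ gradedPart k Δ 1) {w : W} (hw : ({w} : Finset W) ∈ Δ') :
    linCoeff Δ' (restrict k h θ) w = linCoeff Δ θ w := by
  conv_lhs => rw [eq_sum_linCoeff hθ]
  rw [map_sum]
  simp only [map_smul, restrict_faceVar]
  exact linCoeff_sum Δ' _ hw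

end Functoriality

/-! ### Substituting linear forms for the vertices of `E' \ E` -/

section Substitution

variable {k : Type*} [Field k] {W : Type*} [DecidableEq W]
  (Γ : SimplComplex W) {E E' : Finset W} (hE : E ∈ Γ) (hE' : E' ∈ Γ) (h : E ⊆ E')

/-- The retraction `k[Star(E' \ E)] → k[lk(E')]` that replaces `x_w` by `g w` for `w ∈ E' \ E`. -/
def starSubst (g : W → FaceRing k (Γ.link E' hE')) :
    FaceRing k (starIn Γ hE hE' h) →ₐ[k] FaceRing k (Γ.link E' hE') :=
  faceLift _ (fun w => if w ∈ E' \ E then g w else faceVar k _ w) (by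
    intro F hF
    -- The star is a cone over every vertex of E' \ E, so non-faces remain non-faces when these
    -- vertices are removed. Hence the monomial of F already vanishes through its factors outside E'
    -- \ E, whatever g is.
    have hF' : F \ (E' \ E) ∉ Γ.link E' hE' := by
      rintro ⟨hd, hu⟩
      refine hF ⟨?_, ?_⟩
      · refine Finset.disjoint_union_left.2 ⟨?_, Finset.sdiff_disjoint⟩
        rw [Finset.disjoint_left] at hd ⊢
        intro w hw hwE
        exact hd (Finset.mem_sdiff.2 ⟨hw, fun h' => (Finset.mem_sdiff.1 h').2 hwE⟩) (h hwE)
      · refine Γ.down_closed hu ?_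
        intro w hw
        have := @h w
        simp only [Finset.mem_union, Finset.mem_sdiff] at hw ⊢
        tauto
    rw [← Finset.prod_sdiff (Finset.inter_subset_left : F ∩ (E' \ E) ⊆ F),
      Finset.sdiff_inter_self_left,
      Finset.prod_congr rfl fun w hw => if_neg (Finset.mem_sdiff.1 hw).2,
      ← faceMonomial_eq_prod, faceMonomial_eq_zero k hF', zero_mul])

variable (g : W → FaceRing k (Γ.link E' hE'))

theorem starSubst_faceVar_of_mem {w : W} (hw : w ∈ E' \ E) :
    starSubst Γ hE hE' h g (faceVar k _ w) = g w := by
  rw [starSubst, faceLift_faceVar, if_pos hw]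

theorem starSubst_faceVar_of_notMem {w : W} (hw : w ∉ E' \ E) :
    starSubst Γ hE hE' h g (faceVar k _ w) = faceVar k _ w := by
  rw [starSubst, faceLift_faceVar, if_neg hw]

/-- A vertex of the star outside E' \ E is a vertex of lk(E'); for any other such w both sides are
0. -/
theorem fullInclusion_faceVar {w : W} (hw : w ∉ E' \ E) :
    fullInclusion k (link_full_starIn Γ hE hE' h) (faceVar k _ w) = faceVar k _ w := by
  by_cases hv : ({w} : Finset W) ∈ Γ.link E' hE'
  · exact faceInclusion_faceVar (link_le_starIn Γ hE hE' h) hv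
  · rw [faceVar_eq_zero k hv, map_zero, faceVar_eq_zero]
    rintro ⟨hd, hu⟩
    rw [union_sdiff_union _ h] at hu
    refine hv ⟨?_, hu⟩
    rw [Finset.disjoint_singleton_left]
    intro hwE'
    rw [Finset.disjoint_union_left, Finset.disjoint_singleton_left] at hd
    exact hw (Finset.mem_sdiff.2 ⟨hwE', hd.1⟩)

theorem notMem_sdiff_of_mem_link {w : W} (hw : ({w} : Finset W) ∈ Γ.link E' hE') :
    w ∉ E' \ E := fun h' =>
  Finset.disjoint_singleton_left.1 hw.1 (Finset.mem_sdiff.1 h').1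

theorem starSubst_fullInclusion (r : FaceRing k (Γ.link E' hE')) :
    starSubst Γ hE hE' h g (fullInclusion k (link_full_starIn Γ hE hE' h) r) = r := by
  have : (starSubst Γ hE hE' h g).comp (fullInclusion k (link_full_starIn Γ hE hE' h)) =
      AlgHom.id k _ := by
    refine faceRing_algHom_ext fun w => ?_
    by_cases hv : ({w} : Finset W) ∈ Γ.link E' hE'
    · have hw := notMem_sdiff_of_mem_link (E := E) Γ hE' hv
      rw [AlgHom.comp_apply, fullInclusion_faceVar Γ hE hE' h hw,
        starSubst_faceVar_of_notMem Γ hE hE' h g hw, AlgHom.id_apply]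
    · rw [faceVar_eq_zero k hv, map_zero, map_zero]
  exact DFunLike.congr_fun this r

/-- Substituting congruent elements for the variables does not change a class modulo I; it suffices
to compare two algebra maps on variables. -/
theorem sub_fullInclusion_starSubst_mem {I : Ideal (FaceRing k (starIn Γ hE hE' h))}
    (hg : ∀ w ∈ E' \ E, faceVar k _ w - fullInclusion k (link_full_starIn Γ hE hE' h) (g w) ∈ I)
    (y : FaceRing k (starIn Γ hE hE' h)) :
    y - fullInclusion k (link_full_starIn Γ hE hE' h) (starSubst Γ hE hE' h g y) ∈ I := by
  have : Ideal.Quotient.mkₐ k I = ((Ideal.Quotient.mkₐ k I).comp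
      (fullInclusion k (link_full_starIn Γ hE hE' h))).comp (starSubst Γ hE hE' h g) := by
    refine faceRing_algHom_ext fun w => ?_
    rw [AlgHom.comp_apply, AlgHom.comp_apply]
    by_cases hw : w ∈ E' \ E
    · rw [starSubst_faceVar_of_mem Γ hE hE' h g hw]
      exact Ideal.Quotient.eq.2 (hg w hw)
    · rw [starSubst_faceVar_of_notMem Γ hE hE' h g hw, fullInclusion_faceVar Γ hE hE' h hw]
  exact Ideal.Quotient.eq.1 (DFunLike.congr_fun this y)

theorem starSubst_mem_gradedPart (hg : ∀ w, g w ∈ gradedPart k (Γ.link E' hE') 1) {i : ℕ}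
    {x : FaceRing k (Γ.link E hE)} (hx : x ∈ gradedPart k (Γ.link E hE) i) :
    starSubst Γ hE hE' h g (restrict k (starIn_le Γ hE hE' h) x) ∈
      gradedPart k (Γ.link E' hE') i := by
  refine map_gradedPart_of_faceVar
    ((starSubst Γ hE hE' h g).comp (restrict k (starIn_le Γ hE hE' h))) (fun w => ?_) hx
  rw [AlgHom.comp_apply, restrict_faceVar]
  by_cases hw : w ∈ E' \ E
  · rw [starSubst_faceVar_of_mem Γ hE hE' h g hw]
    exact hg w
  · rw [starSubst_faceVar_of_notMem Γ hE hE' h g hw]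
    exact faceVar_mem_gradedPart _ w

theorem starSubst_faceMonomial (F : Finset W) :
    ∃ a, starSubst Γ hE hE' h g (faceMonomial k _ F) =
      a * faceMonomial k (Γ.link E' hE') (F \ (E' \ E)) := by
  refine ⟨starSubst Γ hE hE' h g (∏ w ∈ F ∩ (E' \ E), faceVar k _ w), ?_⟩
  rw [faceMonomial_eq_prod, ← Finset.prod_sdiff (Finset.inter_subset_left : F ∩ (E' \ E) ⊆ F),
    map_mul, mul_comm, Finset.sdiff_inter_self_left, map_prod _ _ (F \ (E' \ E)),
    faceMonomial_eq_prod]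
  congr 1
  exact Finset.prod_congr rfl fun w hw =>
    starSubst_faceVar_of_notMem Γ hE hE' h g (Finset.mem_sdiff.1 hw).2

variable [Fintype W]

/-- The restriction of a linear form to `lk(E')` has no part on `E' \ E`. -/
theorem restrict_link_eq {θ : FaceRing k (Γ.link E hE)}
    (hθ : θ ∈ gradedPart k (Γ.link E hE) 1) :
    restrict k (link_le_link Γ hE hE' h) θ =
      ∑ w ∈ Finset.univ \ (E' \ E), linCoeff _ θ w • faceVar k _ w := by
  conv_lhs => rw [eq_sum_linCoeff hθ, map_sum]
  simp only [map_smul, restrict_faceVar]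
  refine (Finset.sum_subset (Finset.subset_univ _) fun w _ hw => ?_).symm
  have hw' : w ∈ E' \ E := by
    by_contra hc
    exact hw (Finset.mem_sdiff.2 ⟨Finset.mem_univ _, hc⟩)
  rw [faceVar_eq_zero k fun hv => notMem_sdiff_of_mem_link (E := E) Γ hE' hv hw', smul_zero]

/-- A linear form is split into its part on `E' \ E` and the remaining part. -/
theorem starSubst_linear {θ : FaceRing k (Γ.link E hE)}
    (hθ : θ ∈ gradedPart k (Γ.link E hE) 1) :
    starSubst Γ hE hE' h g (restrict k (starIn_le Γ hE hE' h) θ) =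
      (∑ w : ↥(E' \ E), linCoeff _ θ w • g w) +
        restrict k (link_le_link Γ hE hE' h) θ := by
  rw [restrict_link_eq Γ hE hE' h hθ]
  conv_lhs => rw [eq_sum_linCoeff hθ, map_sum, map_sum]
  simp only [map_smul, restrict_faceVar]
  rw [← Finset.sum_sdiff (Finset.subset_univ (E' \ E)), add_comm, ← Finset.sum_coe_sort]
  congr 1
  · exact Finset.sum_congr rfl fun w _ => by
      rw [starSubst_faceVar_of_mem Γ hE hE' h g w.2]
  · exact Finset.sum_congr rfl fun w hw => by
      rw [starSubst_faceVar_of_notMem Γ hE hE' h g (Finset.mem_sdiff.1 hw).2]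

theorem restrict_star_eq {θ : FaceRing k (Γ.link E hE)}
    (hθ : θ ∈ gradedPart k (Γ.link E hE) 1) :
    restrict k (starIn_le Γ hE hE' h) θ =
      (∑ w : ↥(E' \ E), linCoeff _ θ w • faceVar k _ (w : W)) +
        fullInclusion k (link_full_starIn Γ hE hE' h)
          (restrict k (link_le_link Γ hE hE' h) θ) := by
  rw [restrict_link_eq Γ hE hE' h hθ, map_sum]
  conv_lhs => rw [eq_sum_linCoeff hθ, map_sum]
  simp only [map_smul, restrict_faceVar]
  rw [← Finset.sum_sdiff (Finset.subset_univ (E' \ E)), add_comm, ← Finset.sum_coe_sort]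
  congr 1
  exact Finset.sum_congr rfl fun w hw => by
    rw [fullInclusion_faceVar Γ hE hE' h (Finset.mem_sdiff.1 hw).2]

/-- Some `|E' \ E|` of the forms can be solved for the variables of `E' \ E` on the star. -/
theorem exists_substitution {ι : Type*} [Fintype ι] {θ : ι → FaceRing k (Γ.link E hE)}
    (hθ : ∀ i, θ i ∈ gradedPart k (Γ.link E hE) 1)
    [FiniteDimensional k (FaceRing k (Γ.link E hE) ⧸ Ideal.span (Set.range θ))] :
    ∃ (R : Finset ι) (g : W → FaceRing k (Γ.link E' hE')),
      R.card = (E' \ E).card ∧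
      (∀ w, g w ∈ gradedPart k (Γ.link E' hE') 1) ∧
      (∀ i ∈ R, starSubst Γ hE hE' h g (restrict k (starIn_le Γ hE hE' h) (θ i)) = 0) ∧
      (∀ w ∈ E' \ E, faceVar k _ w - fullInclusion k (link_full_starIn Γ hE hE' h) (g w) ∈
        Ideal.span (Set.range fun i => restrict k (starIn_le Γ hE hE' h) (θ i))) ∧
      ∀ i ∈ R, ∃ w ∈ E' \ E, linCoeff _ (θ i) w ≠ 0 := by
  classical
  have hD := sdiff_mem_link Γ hE hE' h
  let M : ι → (↥(E' \ E) → k) := fun i w => linCoeff _ (θ i) w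
  have hM : Submodule.span k (Set.range M) = ⊤ := span_linCoeff_eq_top hθ hD
  -- The rows of the coefficient matrix on E' \ E span, so some of them, indexed through `a`, form a
  -- basis; R will be the image of `a`.
  obtain ⟨κ, a, ha, hspan, hli⟩ := exists_linearIndependent' k M
  have : Finite κ := Finite.of_injective a ha
  have := Fintype.ofFinite κ
  let b : Module.Basis κ k (↥(E' \ E) → k) := Module.Basis.mk hli (by rw [hspan, hM])
  have hb : ∀ j, b j = M (a j) := fun j => by simp [b]
  -- Solving without inverting a matrix: θ = 0 says that the part of θ on E' \ E equals minus its
  -- restriction to lk(E'). `L` prescribes this on the basis of rows, and its values on the unit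
  -- vectors are the solutions g_w.
  let L : (↥(E' \ E) → k) →ₗ[k] FaceRing k (Γ.link E' hE') :=
    b.constr k fun j => -restrict k (link_le_link Γ hE hE' h) (θ (a j))
  have hL : ∀ j, L (M (a j)) = -restrict k (link_le_link Γ hE hE' h) (θ (a j)) := fun j => by
    rw [← hb]
    exact b.constr_basis k _ j
  let g : W → FaceRing k (Γ.link E' hE') := fun w =>
    if hw : w ∈ E' \ E then L (Pi.single ⟨w, hw⟩ 1) else 0
  have hgw : ∀ w : ↥(E' \ E), g w = L (Pi.single w 1) := fun w => dif_pos w.2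
  have hgL : ∀ c : ↥(E' \ E) → k, ∑ w : ↥(E' \ E), c w • g w = L c := by
    intro c
    conv_rhs => rw [pi_eq_sum_univ' c]
    simp only [map_sum, map_smul, hgw]
  refine ⟨Finset.univ.image a, g, ?_, ?_, ?_, ?_, ?_⟩
  · rw [Finset.card_image_of_injective _ ha, Finset.card_univ,
      ← Module.finrank_eq_card_basis b, Module.finrank_fintype_fun_eq_card, Fintype.card_coe]
  · intro w
    by_cases hw : w ∈ E' \ E
    · simp only [g, dif_pos hw]
      have hr : LinearMap.range L ≤ gradedPart k (Γ.link E' hE') 1 := by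
        rw [Module.Basis.constr_range, Submodule.span_le]
        rintro _ ⟨j, rfl⟩
        exact neg_mem (map_gradedPart_of_faceVar _
          (fun u => faceVar_mem_gradedPart _ u) (hθ (a j)))
      exact hr ⟨_, rfl⟩
    · simp only [g, dif_neg hw]
      exact zero_mem _
  · intro i hi
    obtain ⟨j, -, rfl⟩ := Finset.mem_image.1 hi
    rw [starSubst_linear Γ hE hE' h g (hθ _), hgL (M (a j)), hL, neg_add_cancel]
  · intro w hw
    set I := Ideal.span (Set.range fun i => restrict k (starIn_le Γ hE hE' h) (θ i))
    let G : (↥(E' \ E) → k) →ₗ[k] FaceRing k (starIn Γ hE hE' h) :=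
      Fintype.linearCombination k fun w : ↥(E' \ E) => faceVar k _ (w : W)
    -- On a basis row the difference of the two sides is the restricted form θ'_i itself, so the
    -- maps agree modulo I; unit vectors then give the congruence for each x_w.
    have hG : (Ideal.Quotient.mkₐ k I).toLinearMap ∘ₗ G =
        (Ideal.Quotient.mkₐ k I).toLinearMap ∘ₗ
          (fullInclusion k (link_full_starIn Γ hE hE' h)).toLinearMap ∘ₗ L := by
      refine b.ext fun j => ?_
      rw [hb]
      refine Ideal.Quotient.eq.2 ?_
      change G (M (a j)) - fullInclusion k (link_full_starIn Γ hE hE' h) (L (M (a j))) ∈ I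
      rw [hL, map_neg, sub_neg_eq_add]
      have hmem : restrict k (starIn_le Γ hE hE' h) (θ (a j)) ∈ I :=
        Ideal.subset_span ⟨a j, rfl⟩
      rw [restrict_star_eq Γ hE hE' h (hθ (a j))] at hmem
      exact hmem
    have := Ideal.Quotient.eq.1 (LinearMap.congr_fun hG (Pi.single ⟨w, hw⟩ 1))
    change G _ - fullInclusion k (link_full_starIn Γ hE hE' h) (L _) ∈ I at this
    rw [← hgw ⟨w, hw⟩] at this
    simpa [G] using this
  · intro i hi
    obtain ⟨j, -, rfl⟩ := Finset.mem_image.1 hi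
    -- A row of a basis is nonzero. This is what later keeps the labelled forms out of R.
    by_contra! hc
    refine b.ne_zero j ?_
    rw [hb]
    exact funext fun w => hc w w.2

end Substitution

/-! ### The transfer map -/

section Transfer

variable {k : Type*} [Field k] {W V : Type*} [DecidableEq W]
  (T : CarriedComplex W V) {E E' : Finset W} (hE : E ∈ T.complex) (hE' : E' ∈ T.complex)
  (h : E ⊆ E')

/-- The substitution homomorphism `k[lk(E)] → k[lk(E')]` through the star of `E' \ E`. -/
def linkSubst (g : W → FaceRing k (T.lk E' hE')) :
    FaceRing k (T.lk E hE) →ₐ[k] FaceRing k (T.lk E' hE') :=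
  (starSubst T.complex hE hE' h g).comp (restrict k (starIn_le T.complex hE hE' h))

theorem linkSubst_apply (g : W → FaceRing k (T.lk E' hE')) (x : FaceRing k (T.lk E hE)) :
    linkSubst T hE hE' h g x =
      starSubst T.complex hE hE' h g (restrict k (starIn_le T.complex hE hE' h) x) :=
  rfl

theorem linkSubst_faceInclusion (g : W → FaceRing k (T.lk E' hE'))
    (r : FaceRing k (T.lk E' hE')) :
    linkSubst T hE hE' h g (faceInclusion k (link_le_link T.complex hE hE' h) r) = r := by
  rw [linkSubst_apply,
    restrict_faceInclusion _ (link_le_starIn T.complex hE hE' h)]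
  exact starSubst_fullInclusion T.complex hE hE' h g r

theorem linkSubst_surjective (g : W → FaceRing k (T.lk E' hE')) :
    Function.Surjective (linkSubst T hE hE' h g) := fun r =>
  ⟨_, linkSubst_faceInclusion T hE hE' h g r⟩

variable {d : ℕ} {θ : Fin d → FaceRing k (T.lk E hE)} {g : W → FaceRing k (T.lk E' hE')}
-- The substitution s fixes k[lk(E')], so r ∈ J gives r = s(r) in the image of (θ'). Conversely s(y)
-- ≡ y modulo (θ'), so s maps (θ') into J.
theorem contractedIdeal_eq_span
    (hg : ∀ w ∈ E' \ E,
      faceVar k _ w - fullInclusion k (link_full_starIn T.complex hE hE' h) (g w) ∈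
        Ideal.span (Set.range fun i => restrict k (starIn_le T.complex hE hE' h) (θ i))) :
    contractedIdeal k T hE hE' h θ =
      Ideal.span (Set.range fun i => linkSubst T hE hE' h g (θ i)) := by
  have hrange : Ideal.span (Set.range fun i => linkSubst T hE hE' h g (θ i)) =
      (Ideal.span (Set.range fun i => restrict k (starIn_le T.complex hE hE' h) (θ i))).map
        (starSubst T.complex hE hE' h g) := by
    rw [Ideal.map_span, ← Set.range_comp]
    rfl
  have hsub := sub_fullInclusion_starSubst_mem T.complex hE hE' h g hg
  rw [hrange]
  apply le_antisymm
  · intro r hr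
    rw [← starSubst_fullInclusion T.complex hE hE' h g r]
    exact Ideal.mem_map_of_mem _ hr
  · rw [Ideal.map_le_iff_le_comap]
    intro y hy
    have := sub_mem hy (hsub y)
    rwa [sub_sub_cancel] at this

/-- Linearity determines φ on the image of k[lk(E')]. On the star, y agrees modulo (θ') with its
substituted form r, so y - ι(r) is an element of (θ) plus one vanishing on the star, and φ kills
both. -/
theorem IsTransferMap.apply_mk
    (hg : ∀ w ∈ E' \ E,
      faceVar k _ w - fullInclusion k (link_full_starIn T.complex hE hE' h) (g w) ∈
        Ideal.span (Set.range fun i => restrict k (starIn_le T.complex hE hE' h) (θ i)))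
    {φ : (FaceRing k (T.lk E hE) ⧸ Ideal.span (Set.range θ)) →ₐ[k]
      (FaceRing k (T.lk E' hE') ⧸ contractedIdeal k T hE hE' h θ)}
    (hφ : IsTransferMap k T hE hE' h θ φ) (y : FaceRing k (T.lk E hE)) :
    φ (Ideal.Quotient.mk _ y) = Ideal.Quotient.mk _ (linkSubst T hE hE' h g y) := by
  set r := linkSubst T hE hE' h g y
  set ρ := restrict k (starIn_le T.complex hE hE' h)
  have hlin : φ (Ideal.Quotient.mk _ (faceInclusion k (link_le_link T.complex hE hE' h) r)) =
      Ideal.Quotient.mk _ r := by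
    refine (congrArg φ (mul_one _)).symm.trans ((hφ.linear r 1).trans ?_)
    rw [map_one]
    exact congrArg (Ideal.Quotient.mk _) (mul_one r)
  have hmem : ρ (y - faceInclusion k (link_le_link T.complex hE hE' h) r) ∈
      (Ideal.span (Set.range θ)).map ρ := by
    rw [map_sub, restrict_faceInclusion _ (link_le_starIn T.complex hE hE' h), Ideal.map_span,
      ← Set.range_comp]
    exact sub_fullInclusion_starSubst_mem T.complex hE hE' h g hg (ρ y)
  -- Restriction to the star is surjective, so the element of (θ') lifts to an element t of (θ).
  obtain ⟨t, ht, htρ⟩ := (Ideal.mem_map_iff_of_surjective ρ (restrict_surjective _)).1 hmem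
  have hker := ker_restrict_le (starIn_le T.complex hE hE' h)
    (I := RingHom.ker (φ.toRingHom.comp (Ideal.Quotient.mk (Ideal.span (Set.range θ)))))
    hφ.kills (x := y - faceInclusion k (link_le_link T.complex hE hE' h) r - t)
    (by rw [RingHom.mem_ker, map_sub]; exact sub_eq_zero.2 htρ.symm)
  change φ (Ideal.Quotient.mk _ _) = 0 at hker
  rw [map_sub, map_sub, Ideal.Quotient.eq_zero_iff_mem.2 ht, map_sub, map_sub, hlin, map_zero,
    sub_zero, sub_eq_zero] at hker
  exact hker

theorem exists_isTransferMap
    (hg : ∀ w ∈ E' \ E,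
      faceVar k _ w - fullInclusion k (link_full_starIn T.complex hE hE' h) (g w) ∈
        Ideal.span (Set.range fun i => restrict k (starIn_le T.complex hE hE' h) (θ i)))
    (hg1 : ∀ w, g w ∈ gradedPart k (T.lk E' hE') 1) :
    ∃ φ : (FaceRing k (T.lk E hE) ⧸ Ideal.span (Set.range θ)) →ₐ[k]
      (FaceRing k (T.lk E' hE') ⧸ contractedIdeal k T hE hE' h θ),
      IsTransferMap k T hE hE' h θ φ := by
  have hJ := contractedIdeal_eq_span T hE hE' h hg
  have hle : Ideal.span (Set.range θ) ≤
      (contractedIdeal k T hE hE' h θ).comap (linkSubst T hE hE' h g) := by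
    rw [Ideal.span_le, hJ]
    rintro _ ⟨i, rfl⟩
    exact Ideal.subset_span ⟨i, rfl⟩
  refine ⟨Ideal.quotientMapₐ _ (linkSubst T hE hE' h g) hle, ?_, ?_, ?_⟩
  · rintro i _ ⟨x, hx, rfl⟩
    exact ⟨_, starSubst_mem_gradedPart T.complex hE hE' h g hg1 hx, rfl⟩
  · intro r y
    obtain ⟨y, rfl⟩ := Ideal.Quotient.mk_surjective y
    rw [map_mul]
    exact congrArg (fun a => Ideal.Quotient.mk _ (a * linkSubst T hE hE' h g y))
      (linkSubst_faceInclusion T hE hE' h g r)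
  · intro F _ hF
    have : linkSubst T hE hE' h g (faceMonomial k (T.lk E hE) F) = 0 := by
      rw [linkSubst_apply, restrict_faceMonomial, faceMonomial_eq_zero k hF, map_zero]
    exact Ideal.Quotient.eq_zero_iff_mem.2 (this ▸ zero_mem _)

theorem existsUnique_isTransferMap
    (hg : ∀ w ∈ E' \ E,
      faceVar k _ w - fullInclusion k (link_full_starIn T.complex hE hE' h) (g w) ∈
        Ideal.span (Set.range fun i => restrict k (starIn_le T.complex hE hE' h) (θ i)))
    (hg1 : ∀ w, g w ∈ gradedPart k (T.lk E' hE') 1) :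
    ∃! φ : (FaceRing k (T.lk E hE) ⧸ Ideal.span (Set.range θ)) →ₐ[k]
      (FaceRing k (T.lk E' hE') ⧸ contractedIdeal k T hE hE' h θ),
      IsTransferMap k T hE hE' h θ φ := by
  obtain ⟨φ, hφ⟩ := exists_isTransferMap T hE hE' h hg hg1
  refine ⟨φ, hφ, fun φ' hφ' => AlgHom.ext fun y => ?_⟩
  obtain ⟨y, rfl⟩ := Ideal.Quotient.mk_surjective y
  rw [hφ.apply_mk T hE hE' h hg, hφ'.apply_mk T hE hE' h hg]

/-- The transfer map sends the local face module of `E` into the one of `E'`. -/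
theorem IsTransferMap.map_localFaceModule [Fintype V] {d' : ℕ}
    (hg : ∀ w ∈ E' \ E,
      faceVar k _ w - fullInclusion k (link_full_starIn T.complex hE hE' h) (g w) ∈
        Ideal.span (Set.range fun i => restrict k (starIn_le T.complex hE hE' h) (θ i)))
    {ζ : Fin d' → FaceRing k (T.lk E' hE')}
    (hζ : contractedIdeal k T hE hE' h θ = Ideal.span (Set.range ζ))
    {φ : (FaceRing k (T.lk E hE) ⧸ Ideal.span (Set.range θ)) →ₐ[k]
      (FaceRing k (T.lk E' hE') ⧸ contractedIdeal k T hE hE' h θ)}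
    (hφ : IsTransferMap k T hE hE' h θ φ) {x : FaceRing k (T.lk E hE) ⧸ Ideal.span (Set.range θ)}
    (hx : x ∈ localFaceModule k T E hE θ) :
    Ideal.quotEquivOfEq hζ (φ x) ∈ localFaceModule k T E' hE' ζ := by
  suffices hle : localFaceModule k T E hE θ ≤ (localFaceModule k T E' hE' ζ).comap
      ((Ideal.quotEquivOfEq hζ).toRingHom.comp φ.toRingHom) from hle hx
  rw [localFaceModule, Ideal.map_le_iff_le_comap, interiorIdeal, Ideal.span_le]
  rintro _ ⟨F, hF, hFV, rfl⟩
  change Ideal.quotEquivOfEq hζ (φ (Ideal.Quotient.mk _ _)) ∈ localFaceModule k T E' hE' ζ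
  by_cases hFs : F ∈ starIn T.complex hE hE' h
  · rw [hφ.apply_mk T hE hE' h hg, Ideal.quotEquivOfEq_mk, linkSubst_apply,
      restrict_faceMonomial]
    -- Only the factors in E' \ E are altered, so the image is a multiple of the monomial of F \ (E'
    -- \ E). Joined with E' this face is F ∪ E', which contains the interior face F ∪ E.
    obtain ⟨a, ha⟩ := starSubst_faceMonomial T.complex hE hE' h g F
    rw [ha]
    refine Ideal.mem_map_of_mem _ (Ideal.mul_mem_left _ _ (Ideal.subset_span
      ⟨F \ (E' \ E), ?_, ?_, rfl⟩))
    all_goals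
      have hun : F ∪ E' ∈ T.complex := by
        have := hFs.2
        rwa [union_sdiff_union F h] at this
      have heq : F \ (E' \ E) ∪ E' = F ∪ E' := by
        ext w
        simp only [Finset.mem_union, Finset.mem_sdiff]
        tauto
    · refine ⟨?_, by rwa [heq]⟩
      have hd := hF.1
      rw [Finset.disjoint_left] at hd ⊢
      intro w hw hwE'
      rw [Finset.mem_sdiff, Finset.mem_sdiff] at hw
      exact hw.2 ⟨hwE', hd hw.1⟩
    · rw [heq]
      exact Finset.univ_subset_iff.1
        (hFV ▸ T.carrier_mono hun (Finset.union_subset_union_right h))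
  · rw [hφ.kills F hF hFs, map_zero]
    exact zero_mem _

end Transfer

end LocalFace

end

/-! ### The special l.s.o.p. for the smaller link and the proof of the theorem -/

open LocalFace
theorem theorem1p4 {k : Type*} [Field k] [Infinite k]
    {W V : Type*} [Fintype W] [DecidableEq W] [Fintype V]
    (T : CarriedComplex W V)
    (hT : IsHomologyTriangulation k T) (hqg : IsQuasiGeometric T)
    {E E' : Finset W} (hE : E ∈ T.complex) (hE' : E' ∈ T.complex) (hEE' : E ⊆ E')
    (θ : Fin (Fintype.card V - E.card) → FaceRing k (T.lk E hE))
    (hθ : IsSpecialLSOP k T E hE θ) :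
    (∃! φ : (FaceRing k (T.lk E hE) ⧸ Ideal.span (Set.range θ)) →ₐ[k]
        (FaceRing k (T.lk E' hE') ⧸ contractedIdeal k T hE hE' hEE' θ),
      IsTransferMap k T hE hE' hEE' θ φ) ∧
    ∀ τ : {v : V // v ∉ T.carrier E} → Fin (Fintype.card V - E.card),
      IsSpecialLabelling k T E hE θ τ →
      ∃ (ζ : Fin (Fintype.card V - E'.card) → FaceRing k (T.lk E' hE'))
        (τ' : {v : V // v ∉ T.carrier E'} → Fin (Fintype.card V - E'.card))
        (hζ : contractedIdeal k T hE hE' hEE' θ = Ideal.span (Set.range ζ)),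
        IsSpecialLSOP k T E' hE' ζ ∧
        IsSpecialLabelling k T E' hE' ζ τ' ∧
        (∀ v : {v : V // v ∉ T.carrier E'},
          restrict k (link_le_link T.complex hE hE' hEE') (θ (τ (outsideVertex T hE' hEE' v))) =
            ζ (τ' v)) ∧
        ∀ φ : (FaceRing k (T.lk E hE) ⧸ Ideal.span (Set.range θ)) →ₐ[k]
            (FaceRing k (T.lk E' hE') ⧸ contractedIdeal k T hE hE' hEE' θ),
          IsTransferMap k T hE hE' hEE' θ φ →
          ∀ x ∈ localFaceModule k T E hE θ,
            Ideal.quotEquivOfEq hζ (φ x) ∈ localFaceModule k T E' hE' ζ := by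
  classical
  obtain ⟨⟨-, hθ1, hfin⟩, -⟩ := hθ
  obtain ⟨R, g, hRcard, hg1, hgR, hg, hRne⟩ := exists_substitution T.complex hE hE' hEE' hθ1
  refine ⟨existsUnique_isTransferMap T hE hE' hEE' hg hg1, fun τ hτ => ?_⟩
  -- The forms outside R number (n - |E|) - (|E'| - |E|) and will be reindexed to give ζ.
  have hcard : Fintype.card {i // i ∉ R} = Fintype.card V - E'.card := by
    rw [Fintype.card_subtype_compl, Fintype.card_fin, Fintype.card_coe, hRcard,
      Finset.card_sdiff_of_subset hEE']
    have := Finset.card_le_card hEE'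
    omega
  let e := Fintype.equivFinOfCardEq hcard
  -- A vertex w of E' in the support of θ_v would have v in its carrier, hence v in σ(E').
  have hcoeff : ∀ (v : {v : V // v ∉ T.carrier E'}), ∀ w ∈ E' \ E,
      linCoeff _ (θ (τ (outsideVertex T hE' hEE' v))) w = 0 := by
    intro v w hw
    by_contra hne
    have hwv := (hτ.2 (outsideVertex T hE' hEE' v) hne).2
    exact v.2 (T.carrier_mono hE'
      (Finset.singleton_subset_iff.2 (Finset.mem_sdiff.1 hw).1) hwv)
  have hτR : ∀ v, τ (outsideVertex T hE' hEE' v) ∉ R := fun v hv => by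
    obtain ⟨w, hw, hne⟩ := hRne _ hv
    exact hne (hcoeff v w hw)
  let ζ : Fin (Fintype.card V - E'.card) → FaceRing k (T.lk E' hE') := fun j =>
    linkSubst T hE hE' hEE' g (θ (e.symm j))
  let τ' : {v : V // v ∉ T.carrier E'} → Fin (Fintype.card V - E'.card) := fun v =>
    e ⟨τ (outsideVertex T hE' hEE' v), hτR v⟩
  have hζ : contractedIdeal k T hE hE' hEE' θ = Ideal.span (Set.range ζ) := by
    rw [contractedIdeal_eq_span T hE hE' hEE' hg]
    refine le_antisymm (Ideal.span_le.2 ?_) (Ideal.span_mono ?_)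
    · rintro _ ⟨i, rfl⟩
      by_cases hi : i ∈ R
      · simp only [linkSubst_apply, hgR i hi]
        exact zero_mem _
      · exact Ideal.subset_span ⟨e ⟨i, hi⟩, by simp [ζ]⟩
    · rintro _ ⟨j, rfl⟩
      exact ⟨_, rfl⟩
  have hζ1 : ∀ j, ζ j ∈ gradedPart k (T.lk E' hE') 1 := fun j =>
    starSubst_mem_gradedPart T.complex hE hE' hEE' g hg1 (hθ1 _)
  have hrestr : ∀ v : {v : V // v ∉ T.carrier E'},
      restrict k (link_le_link T.complex hE hE' hEE') (θ (τ (outsideVertex T hE' hEE' v))) =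
        ζ (τ' v) := by
    intro v
    -- With no part on E' \ E, nothing is substituted into θ_v and only its restriction to lk(E')
    -- remains.
    have h0 : ∑ w : ↥(E' \ E),
        linCoeff _ (θ (τ (outsideVertex T hE' hEE' v))) w • g w = 0 :=
      Finset.sum_eq_zero fun w _ => by rw [hcoeff v w w.2, zero_smul]
    simp only [ζ, τ', Equiv.symm_apply_apply]
    rw [linkSubst_apply, starSubst_linear T.complex hE hE' hEE' g (hθ1 _), h0, zero_add]
  have hlab : IsSpecialLabelling k T E' hE' ζ τ' := by
    refine ⟨fun v v' hv => ?_, fun v w hw => ?_⟩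
    · have := hτ.1 (congrArg Subtype.val (e.injective hv))
      exact Subtype.ext (Subtype.mk.inj this)
    · change linCoeff _ (ζ (τ' v)) w ≠ 0 at hw
      have hv : ({w} : Finset W) ∈ T.lk E' hE' := by
        by_contra hc
        exact hw (linCoeff_eq_zero (hζ1 _) hc)
      refine ⟨hv, ?_⟩
      rw [← hrestr, linCoeff_restrict _ (hθ1 _) hv] at hw
      exact (hτ.2 (outsideVertex T hE' hEE' v) hw).2
  -- The substitution is surjective and carries (θ) into (ζ), so this ring is a quotient of the
  -- finite-dimensional k[lk(E)]/(θ).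
  have hfin' : FiniteDimensional k (FaceRing k (T.lk E' hE') ⧸ Ideal.span (Set.range ζ)) := by
    have hle : Ideal.span (Set.range θ) ≤
        (Ideal.span (Set.range ζ)).comap (linkSubst T hE hE' hEE' g) := by
      rw [← hζ, contractedIdeal_eq_span T hE hE' hEE' hg, Ideal.span_le]
      rintro _ ⟨i, rfl⟩
      exact Ideal.subset_span ⟨i, rfl⟩
    exact Module.Finite.of_surjective
      (Ideal.quotientMapₐ _ (linkSubst T hE hE' hEE' g) hle).toLinearMap
      (Ideal.quotientMap_surjective (H := hle) (linkSubst_surjective T hE hE' hEE' g))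
  exact ⟨ζ, τ', hζ, ⟨⟨ringKrullDim_eq_of_dim_eq k (link_dim_eq hT hE'), hζ1, hfin'⟩, τ', hlab⟩,
    hlab, hrestr, fun φ hφ x hx => hφ.map_localFaceModule T hE hE' hEE' hg hζ hx⟩
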